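/- Let $d,n$ be natural numbers and consider a depth-$n$ circuit on a $d$-dimensional Hilbert space with unitary layers $\mathcal U_i(X)=U_iXU_i^\dagger$, $i=1,\dots,n$. Let $\mathcal N_1,\dots,\mathcal N_n$ (the actual noise) be invertible completely positive trace-preserving linear maps on $d\times d$ complex matrices, and let $\tilde{\mathcal N}_1,\dots,\tilde{\mathcal N}_n$ (the estimated noise) be invertible trace-preserving linear maps, for instance invertible quantum channels. Let $\rho_{\rm in}$ be a density matrix and put $$\mathcal U_{n\cdots1}=\mathcal U_n\circ\cdots\circ\mathcal U_1,\qquad \rho^{\rm ideal}_{\rm out}=\mathcal U_{n\cdots1}(\rho_{\rm in}),\qquad \rho^{\rm exp}_{\rm out}=\mathcal N_n\circ\mathcal U_n\circ\cdots\circ\mathcal N_1\circ\mathcal U_1(\rho_{\rm in}).$$ Let $\mathcal U_i^\dagger(X)=U_i^\dagger XU_i$ and $\Delta\mathcal N_i^{-1}=\tilde{\mathcal N}_i^{-1}-\mathcal N_i^{-1}$. The first-order error term is $$\Delta\mathcal N^{(1)}=\sum_{i=1}^n \mathcal U_1^\dagger\circ\tilde{\mathcal N}_1^{-1}\circ\cdots\circ\mathcal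 U_i^\dagger\circ\Delta\mathcal N_i^{-1}\circ\cdots\circ\mathcal U_n^\dagger\circ\tilde{\mathcal N}_n^{-1}$$ (in the $i$-th summand the $i$-th inverse $\tilde{\mathcal N}_i^{-1}$ is replaced by $\Delta\mathcal N_i^{-1}$), and the first-order correction of the mitigated state is $\Delta\rho^{(1)}_{\rm EM}=\mathcal U_{n\cdots1}\circ\Delta\mathcal N^{(1)}(\rho^{\rm exp}_{\rm out})$. Write $\mathbf v(A)$ for the vectorization of a matrix, with $\mathbf v(E_{a,b})=e_b\otimes e_a$, and $\mathbf v(\Phi)$ for the matrix of a linear map $\Phi$, determined by $\mathbf v(\Phi)\mathbf v(A)=\mathbf v(\Phi(A))$; $\|\cdot\|$ is the Euclidean norm of vectors and the induced operator norm of matrices. Assume that $\rho^{\rm ideal}_{\rm out}+\Delta\rho^{(1)}_{\rm EM}$ is positive semidefinite, and define the first-order fidelity between the mitigated state and the ideal output by $$F^{(1)}=F\bigl(\rho^{\rm ideal}_{\rm out}+\Delta\rho^{(1)}_{\rm EM},\ \rho^{\rm ideal}_{\rm out}\bigr),\qquad F(\rho_1,\rho_2)=\operatorname{tr}\sqrt{\sqrt{\rho_1}\,\rho_2\sqrt{\rho_1}}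 .$$ Let $C_{\rm exp}=\|\mathbf v(\mathcal U_{n\cdots1})\|\cdot\|\mathbf v(\rho^{\rm exp}_{\rm out})\|$ and $l_U=\inf_{\|x\|=1}\|\mathbf v(\mathcal U_{n\cdots1})x\|$. Then $$F^{(1)}\le 1-\tfrac14\bigl(l_U\cdot\|\mathbf v(\Delta\mathcal N^{(1)})\,\mathbf v(\rho^{\rm exp}_{\rm out})\|\bigr)^2,$$ and, provided that $\tfrac12\sqrt d\,C_{\rm exp}\|\mathbf v(\Delta\mathcal N^{(1)})\|\le1$, $$\bigl(1-\tfrac12\sqrt d\,C_{\rm exp}\|\mathbf v(\Delta\mathcal N^{(1)})\|\bigr)^2\le F^{(1)} .$$ -/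

import Mathlib

open scoped MatrixOrder ComplexOrder

noncomputable section

namespace QEM

/-- Square complex matrices of size `d`, i.e. linear operators on a `d`-dimensional Hilbert space. -/
abbrev Mat (d : ℕ) : Type := Matrix (Fin d) (Fin d) ℂ

/-- Linear maps on operators; multiplication is composition. -/
abbrev SuperMap (d : ℕ) : Type := Module.End ℂ (Mat d)

/-- Density matrices: positive semidefinite operators of trace one. -/
def IsDensity {d : ℕ} (ρ : Mat d) : Prop := ρ.PosSemidef ∧ ρ.trace = 1

/-- Trace preservation. -/
def IsTracePreserving {d : ℕ} (Φ : SuperMap d) : Prop := ∀ X : Mat d, (Φ X).trace = X.trace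

/-- The ampliation `id_k ⊗ Φ`, acting blockwise on `k × k` block matrices with `d × d` blocks. -/
def ampliation {d : ℕ} (k : ℕ) (Φ : SuperMap d) (X : Matrix (Fin k × Fin d) (Fin k × Fin d) ℂ) :
    Matrix (Fin k × Fin d) (Fin k × Fin d) ℂ :=
  Matrix.of fun p q => Φ (Matrix.of fun i j => X (p.1, i) (q.1, j)) p.2 q.2

/-- Complete positivity: every ampliation preserves positive semidefiniteness. -/
def IsCompletelyPositive {d : ℕ} (Φ : SuperMap d) : Prop :=
  ∀ (k : ℕ) (X : Matrix (Fin k × Fin d) (Fin k × Fin d) ℂ),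
    X.PosSemidef → (ampliation k Φ X).PosSemidef

/-- Quantum channels: completely positive trace-preserving (CPTP) maps. -/
def IsChannel {d : ℕ} (Φ : SuperMap d) : Prop := IsCompletelyPositive Φ ∧ IsTracePreserving Φ

/-- The unitary channel `ρ ↦ U ρ U†`. -/
def unitaryChannel {d : ℕ} (U : Matrix.unitaryGroup (Fin d) ℂ) : SuperMap d where
  toFun ρ := (U : Mat d) * ρ * star (U : Mat d)
  map_add' X Y := by rw [mul_add, add_mul]
  map_smul' c X := by simp

/-- The vectorization `v(A)` of an operator, with `v(E_{a,b}) = e_b ⊗ e_a`, as a vector of the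
Euclidean space `ℂ^d ⊗ ℂ^d`. -/
def vec {d : ℕ} : Mat d ≃ₗ[ℂ] EuclideanSpace ℂ (Fin d × Fin d) where
  toFun A := WithLp.toLp 2 fun p => A p.2 p.1
  invFun x := Matrix.of fun a b => x (b, a)
  map_add' _ _ := rfl
  map_smul' _ _ := rfl
  left_inv _ := rfl
  right_inv _ := rfl

theorem vec_single {d : ℕ} (a b : Fin d) :
    vec (Matrix.single a b (1 : ℂ)) = EuclideanSpace.single (b, a) (1 : ℂ) := by
  ext p
  have h : (a = p.2 ∧ b = p.1) ↔ p = (b, a) := by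
    rw [Prod.ext_iff]; exact ⟨fun h => ⟨h.2.symm, h.1.symm⟩, fun h => ⟨h.2.symm, h.1.symm⟩⟩
  change Matrix.single a b (1 : ℂ) p.2 p.1 = _
  rw [Matrix.single_apply, PiLp.single_apply, if_congr h rfl rfl]

/-- The natural (superoperator) representation `v(Φ)`, i.e. the operator determined by
`v(Φ) v(A) = v(Φ(A))`. Its norm `‖v(Φ)‖` is the one induced by the Euclidean norm. -/
def superop {d : ℕ} (Φ : SuperMap d) :
    EuclideanSpace ℂ (Fin d × Fin d) →L[ℂ] EuclideanSpace ℂ (Fin d × Fin d) :=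
  LinearMap.toContinuousLinearMap (vec.toLinearMap ∘ₗ Φ ∘ₗ vec.symm.toLinearMap)

theorem superop_vec {d : ℕ} (Φ : SuperMap d) (A : Mat d) :
    superop Φ (vec A) = vec (Φ A) := by
  simp [superop]

/-- The fidelity `F(ρ₁, ρ₂) = tr √(√ρ₁ ρ₂ √ρ₁)` of positive semidefinite matrices. -/
def fidelity {d : ℕ} (ρ₁ ρ₂ : Mat d) : ℝ :=
  (CFC.sqrt (CFC.sqrt ρ₁ * ρ₂ * CFC.sqrt ρ₁)).trace.re

/-- The ideal circuit `𝒰_n ∘ ⋯ ∘ 𝒰_1`. The `k`-th layer has index `k - 1`. -/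
def idealCircuit {d n : ℕ} (U : Fin n → Matrix.unitaryGroup (Fin d) ℂ) : SuperMap d :=
  (List.ofFn fun i => unitaryChannel (U i)).reverse.prod

/-- The experimentally implemented circuit `𝒩_n ∘ 𝒰_n ∘ ⋯ ∘ 𝒩_1 ∘ 𝒰_1`. -/
def expCircuit {d n : ℕ} (U : Fin n → Matrix.unitaryGroup (Fin d) ℂ)
    (N : Fin n → Mat d ≃ₗ[ℂ] Mat d) : SuperMap d :=
  (List.ofFn fun i => (N i).toLinearMap * unitaryChannel (U i)).reverse.prod

/-- The error `Δ𝒩_i⁻¹ = 𝒩̃_i⁻¹ - 𝒩_i⁻¹` of the inverse of the estimated noise. -/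
def deltaInv {d n : ℕ} (N N' : Fin n → Mat d ≃ₗ[ℂ] Mat d) (i : Fin n) : SuperMap d :=
  (N' i).symm.toLinearMap - (N i).symm.toLinearMap

/-- The first-order error term
`Δ𝒩⁽¹⁾ = ∑ i, (𝒰_1† ∘ 𝒩̃_1⁻¹) ∘ ⋯ ∘ (𝒰_i† ∘ Δ𝒩_i⁻¹) ∘ ⋯ ∘ (𝒰_n† ∘ 𝒩̃_n⁻¹)`,
where `N` is the actual and `N'` the estimated noise. -/
def firstOrderError {d n : ℕ} (U : Fin n → Matrix.unitaryGroup (Fin d) ℂ)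
    (N N' : Fin n → Mat d ≃ₗ[ℂ] Mat d) : SuperMap d :=
  ∑ i : Fin n, (List.ofFn fun j =>
    unitaryChannel (star (U j)) *
      (if j = i then deltaInv N N' j else (N' j).symm.toLinearMap)).prod

/-- The ideal output state. -/
def idealOut {d n : ℕ} (U : Fin n → Matrix.unitaryGroup (Fin d) ℂ) (ρ : Mat d) : Mat d :=
  idealCircuit U ρ

/-- The experimental output state. -/
def expOut {d n : ℕ} (U : Fin n → Matrix.unitaryGroup (Fin d) ℂ)
    (N : Fin n → Mat d ≃ₗ[ℂ] Mat d) (ρ : Mat d) : Mat d :=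
  expCircuit U N ρ

/-- The first-order approximation of the mitigated state: the ideal output plus the first-order
correction `𝒰_{n⋯1} ∘ Δ𝒩⁽¹⁾ (ρ_out^exp)`. -/
def firstOrderMitigated {d n : ℕ} (U : Fin n → Matrix.unitaryGroup (Fin d) ℂ)
    (N N' : Fin n → Mat d ≃ₗ[ℂ] Mat d) (ρ : Mat d) : Mat d :=
  idealOut U ρ + idealCircuit U (firstOrderError U N N' (expOut U N ρ))

/-- The first-order fidelity `F⁽¹⁾` between the mitigated state and the ideal output. -/
def firstOrderFidelity {d n : ℕ} (U : Fin n → Matrix.unitaryGroup (Fin d) ℂ)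
    (N N' : Fin n → Mat d ≃ₗ[ℂ] Mat d) (ρ : Mat d) : ℝ :=
  fidelity (firstOrderMitigated U N N' ρ) (idealOut U ρ)

/-- The constant `C_exp = ‖v(𝒰_{n⋯1})‖ ‖v(ρ_out^exp)‖`. -/
def cExp {d n : ℕ} (U : Fin n → Matrix.unitaryGroup (Fin d) ℂ)
    (N : Fin n → Mat d ≃ₗ[ℂ] Mat d) (ρ : Mat d) : ℝ :=
  ‖superop (idealCircuit U)‖ * ‖vec (expOut U N ρ)‖

/-- The lower Lipschitz constant `inf_{‖x‖ = 1} ‖v(Φ) x‖` of a map on operators. -/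
def lowerLipschitz {d : ℕ} (Φ : SuperMap d) : ℝ :=
  ⨅ x : {x : EuclideanSpace ℂ (Fin d × Fin d) // ‖x‖ = 1}, ‖superop Φ x.1‖

end QEM

end

open Matrix

namespace QEM
variable {d : ℕ}

/-! Each summand of the first-order error contains one factor that is a difference of two
trace-preserving maps, so the correction is traceless and the mitigated matrix is again a density
matrix. Both bounds then follow from inequalities of Fuchs–van de Graaf type in the Hilbert–Schmidt
norm, `1 - (√d/2)‖ρ - σ‖ ≤ F ≤ 1 - ‖ρ - σ‖²/4`, applied to a difference that is the ideal circuit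
acting on the first-order error.

Lower bound (`one_sub_le_fidelity`): `F = tr |√σ √ρ| ≥ Re tr (√σ √ρ) = 1 - ‖√ρ - √σ‖²/2`, and
`norm_vec_sub_sq_le` returns from the square roots to the states.

Upper bound (`fidelity_le_one_sub`): measuring in an eigenbasis of `ρ - σ` bounds `F` by a classical
fidelity, and tracelessness compares the ℓ¹ and ℓ² norms of the eigenvalues without a dimensional
factor. -/

theorem trace_conjTranspose_mul_self_eq (A : Mat d) :
    (Aᴴ * A).trace = ((∑ i, ∑ j, ‖A i j‖ ^ 2 : ℝ) : ℂ) := by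
  rw [Matrix.trace, Finset.sum_comm]
  push_cast
  refine Finset.sum_congr rfl fun i _ => ?_
  rw [Matrix.diag_apply, Matrix.mul_apply]
  refine Finset.sum_congr rfl fun j _ => ?_
  rw [Matrix.conjTranspose_apply]
  exact Complex.conj_mul' _

theorem norm_vec_sq_eq_sum (A : Mat d) : ‖vec A‖ ^ 2 = ∑ i, ∑ j, ‖A i j‖ ^ 2 := by
  rw [EuclideanSpace.norm_sq_eq, Fintype.sum_prod_type, Finset.sum_comm]
  rfl

/-- The Euclidean norm of a vectorization is the Hilbert–Schmidt norm. -/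
theorem norm_vec_sq (A : Mat d) : ‖vec A‖ ^ 2 = (Aᴴ * A).trace.re := by
  rw [norm_vec_sq_eq_sum, trace_conjTranspose_mul_self_eq, Complex.ofReal_re]

/-- Cauchy–Schwarz for the diagonal entries of a product. -/
theorem norm_conjTranspose_mul_apply_le (X Y : Mat d) (i : Fin d) :
    ‖(Xᴴ * Y) i i‖ ≤ √((Xᴴ * X) i i).re * √((Yᴴ * Y) i i).re := by
  have key (Z : Mat d) : ((Zᴴ * Z) i i).re = ∑ j, ‖Z j i‖ ^ 2 := by
    rw [Matrix.mul_apply, Complex.re_sum]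
    refine Finset.sum_congr rfl fun j _ => ?_
    rw [Matrix.conjTranspose_apply, ← Complex.ofReal_re (‖Z j i‖ ^ 2)]
    congr 1
    push_cast
    exact Complex.conj_mul' _
  rw [key, key, Matrix.mul_apply]
  refine (norm_sum_le _ _).trans ?_
  refine le_trans (le_of_eq ?_) (Real.sum_mul_le_sqrt_mul_sqrt _ _ _)
  refine Finset.sum_congr rfl fun j _ => ?_
  simp

/-- Unitary diagonalization of a Hermitian matrix. -/
theorem exists_unitary_conj_eq_diagonal {A : Mat d} (hA : A.IsHermitian) :
    ∃ (V : Mat d) (l : Fin d → ℝ), Vᴴ * V = 1 ∧ V * Vᴴ = 1 ∧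
      Vᴴ * A * V = Matrix.diagonal fun i => (l i : ℂ) := by
  refine ⟨hA.eigenvectorUnitary, hA.eigenvalues,
    Unitary.coe_star_mul_self hA.eigenvectorUnitary,
    Unitary.coe_mul_star_self hA.eigenvectorUnitary, ?_⟩
  have := hA.conjStarAlgAut_star_eigenvectorUnitary
  rw [Unitary.conjStarAlgAut_star_apply] at this
  exact this

theorem trace_unitary_conj {V : Mat d} (hV : V * Vᴴ = 1) (A : Mat d) :
    (Vᴴ * A * V).trace = A.trace := by
  rw [Matrix.trace_mul_comm, ← mul_assoc, hV, one_mul]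

theorem sqrt_mul_sqrt {A : Mat d} (hA : A.PosSemidef) : CFC.sqrt A * CFC.sqrt A = A :=
  CFC.sqrt_mul_sqrt_self A hA.nonneg

theorem posSemidef_sqrt (A : Mat d) : (CFC.sqrt A).PosSemidef :=
  Matrix.nonneg_iff_posSemidef.mp (CFC.sqrt_nonneg A)

/-! ### Polar decomposition and bounds on the fidelity -/

/-- Half of the polar decomposition: `√(M† M) = W† M` for a contraction `W`. -/
theorem exists_contraction_mul_eq_sqrt (M : Mat d) :
    ∃ W : Mat d, Wᴴ * M = CFC.sqrt (Mᴴ * M) ∧ (1 - Wᴴ * W).PosSemidef := by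
  set P := CFC.sqrt (Mᴴ * M)
  have hPP : P * P = Mᴴ * M := sqrt_mul_sqrt (Matrix.posSemidef_conjTranspose_mul_self M)
  have hPh : P.IsHermitian := (posSemidef_sqrt _).isHermitian
  obtain ⟨V, p, hV, hV', hD⟩ := exists_unitary_conj_eq_diagonal hPh
  set D : Mat d := Matrix.diagonal fun i => (p i : ℂ)
  -- With `0⁻¹ = 0`, `E` is the pseudo-inverse of `D`, so a singular `M` needs no separate
  -- treatment.
  set E : Mat d := Matrix.diagonal fun i => ((p i)⁻¹ : ℂ)
  have hPD : P = V * D * Vᴴ := by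
    rw [← hD]
    simp only [mul_assoc, hV', mul_one]
    rw [← mul_assoc, hV', one_mul]
  have hEh : Eᴴ = E := by
    simp only [E, Matrix.diagonal_conjTranspose]
    congr 1
    ext i
    simp
  have c (X : Mat d) : Vᴴ * (V * X) = X := by rw [← mul_assoc, hV, one_mul]
  have hEDD : E * D * D = D := by
    simp only [E, D, Matrix.diagonal_mul_diagonal]
    congr 1
    ext i
    by_cases h : (p i : ℂ) = 0
    · simp [h]
    · field_simp
  refine ⟨M * (V * E * Vᴴ), ?_, ?_⟩
  · have : (M * (V * E * Vᴴ))ᴴ * M = V * E * Vᴴ * (P * P) := by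
      rw [hPP]
      simp only [Matrix.conjTranspose_mul, Matrix.conjTranspose_conjTranspose, hEh, mul_assoc]
    rw [this, hPD]
    simp only [mul_assoc, c]
    rw [← mul_assoc D, ← mul_assoc E, ← mul_assoc E, hEDD]
  · have : 1 - (M * (V * E * Vᴴ))ᴴ * (M * (V * E * Vᴴ)) = V * (1 - E * D * D * E) * Vᴴ := by
      have : (M * (V * E * Vᴴ))ᴴ * (M * (V * E * Vᴴ)) =
          V * E * Vᴴ * (P * P) * (V * E * Vᴴ) := by
        rw [hPP]
        simp only [Matrix.conjTranspose_mul, Matrix.conjTranspose_conjTranspose, hEh, mul_assoc]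
      rw [this, hPD, mul_sub, sub_mul, mul_one, hV']
      simp only [mul_assoc, c]
    rw [this]
    refine Matrix.PosSemidef.mul_mul_conjTranspose_same ?_ V
    -- The entries are 0 or 1: conjugated by `V`, this is the projection onto the kernel of `P`.
    have : 1 - E * D * D * E = Matrix.diagonal fun i => 1 - ((p i : ℂ) * (p i : ℂ)⁻¹) := by
      rw [hEDD]
      simp only [E, D, Matrix.diagonal_mul_diagonal, ← Matrix.diagonal_one, Matrix.diagonal_sub]
    rw [this]
    refine Matrix.PosSemidef.diagonal fun i => ?_
    by_cases h : (p i : ℂ) = 0 <;> simp [h]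

theorem fidelity_eq {ρ σ : Mat d} (hσ : σ.PosSemidef) :
    fidelity ρ σ = (CFC.sqrt ((CFC.sqrt σ * CFC.sqrt ρ)ᴴ * (CFC.sqrt σ * CFC.sqrt ρ))).trace.re := by
  have h1 := (posSemidef_sqrt ρ).isHermitian.eq
  have h2 := (posSemidef_sqrt σ).isHermitian.eq
  rw [fidelity, Matrix.conjTranspose_mul, h1, h2]
  congr 3
  conv_lhs => rw [← sqrt_mul_sqrt hσ]
  simp only [mul_assoc]

/-- The fidelity is bounded by the classical fidelity of a von Neumann measurement. -/
theorem fidelity_le_sum_sqrt {ρ σ V : Mat d} (hρ : ρ.PosSemidef) (hσ : σ.PosSemidef)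
    (hV : V * Vᴴ = 1) :
    fidelity ρ σ ≤ ∑ i, √((Vᴴ * ρ * V) i i).re * √((Vᴴ * σ * V) i i).re := by
  obtain ⟨W, hW, hWW⟩ := exists_contraction_mul_eq_sqrt (CFC.sqrt σ * CFC.sqrt ρ)
  have hρh := (posSemidef_sqrt ρ).isHermitian.eq
  have hσh := (posSemidef_sqrt σ).isHermitian.eq
  -- The subtracted term is positive semidefinite because `W` is a contraction, so dropping it only
  -- enlarges the diagonal.
  have hX : (W * CFC.sqrt ρ * V)ᴴ * (W * CFC.sqrt ρ * V) =
      Vᴴ * ρ * V - (CFC.sqrt ρ * V)ᴴ * (1 - Wᴴ * W) * (CFC.sqrt ρ * V) := by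
    conv_rhs => enter [1]; rw [← sqrt_mul_sqrt hρ]
    simp only [Matrix.conjTranspose_mul, hρh]
    noncomm_ring
  have hY : (CFC.sqrt σ * V)ᴴ * (CFC.sqrt σ * V) = Vᴴ * σ * V := by
    conv_rhs => rw [← sqrt_mul_sqrt hσ]
    simp only [Matrix.conjTranspose_mul, hσh, mul_assoc]
  have htr : (Wᴴ * (CFC.sqrt σ * CFC.sqrt ρ)).trace =
      ((W * CFC.sqrt ρ * V)ᴴ * (CFC.sqrt σ * V)).trace := by
    have : (W * CFC.sqrt ρ * V)ᴴ * (CFC.sqrt σ * V) =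
        Vᴴ * (CFC.sqrt ρ * (Wᴴ * CFC.sqrt σ)) * V := by
      simp only [Matrix.conjTranspose_mul, hρh, mul_assoc]
    rw [this, trace_unitary_conj hV, Matrix.trace_mul_comm (CFC.sqrt ρ), mul_assoc]
  rw [fidelity_eq hσ, ← hW, htr, Matrix.trace, Complex.re_sum]
  refine Finset.sum_le_sum fun i _ => ?_
  refine (Complex.re_le_norm _).trans ((norm_conjTranspose_mul_apply_le _ _ i).trans ?_)
  rw [hY]
  gcongr
  rw [hX, Matrix.sub_apply]
  exact sub_le_self _ (hWW.conjTranspose_mul_mul_same (CFC.sqrt ρ * V)).diag_nonneg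

/-- In an orthonormal eigenbasis `v i` of `|M|`, Cauchy–Schwarz gives `|⟨v i, M v i⟩| ≤ ‖M v i‖ = p
i`. -/
theorem re_trace_le_trace_sqrt (M : Mat d) :
    M.trace.re ≤ (CFC.sqrt (Mᴴ * M)).trace.re := by
  set P := CFC.sqrt (Mᴴ * M)
  have hPP : P * P = Mᴴ * M := sqrt_mul_sqrt (Matrix.posSemidef_conjTranspose_mul_self M)
  have hPp : P.PosSemidef := posSemidef_sqrt _
  obtain ⟨V, p, hV, hV', hD⟩ := exists_unitary_conj_eq_diagonal hPp.isHermitian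
  rw [← trace_unitary_conj hV' M, ← trace_unitary_conj hV' P, Matrix.trace, Matrix.trace,
    Complex.re_sum, Complex.re_sum]
  refine Finset.sum_le_sum fun i _ => ?_
  have hp : 0 ≤ p i := by
    have := (hPp.conjTranspose_mul_mul_same V).diag_nonneg (i := i)
    rw [hD, Matrix.diagonal_apply_eq] at this
    exact_mod_cast this
  have h := norm_conjTranspose_mul_apply_le V (M * V) i
  have hMM : (M * V)ᴴ * (M * V) = (Vᴴ * P * V) * (Vᴴ * P * V) := by
    have : (Vᴴ * P * V) * (Vᴴ * P * V) = Vᴴ * P * (V * Vᴴ) * P * V := by noncomm_ring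
    rw [this, hV', mul_one, mul_assoc Vᴴ P P, hPP]
    simp only [Matrix.conjTranspose_mul, mul_assoc]
  rw [hMM, hV, hD, Matrix.diagonal_mul_diagonal, Matrix.diagonal_apply_eq, Matrix.one_apply_eq,
    Complex.one_re, Real.sqrt_one, one_mul, ← Complex.ofReal_mul, Complex.ofReal_re,
    Real.sqrt_mul_self hp, ← mul_assoc] at h
  rw [hD, Matrix.diag_apply, Matrix.diag_apply, Matrix.diagonal_apply_eq, Complex.ofReal_re]
  exact (Complex.re_le_norm _).trans h

theorem re_trace_sqrt_mul_sqrt_le_fidelity {ρ σ : Mat d} (hσ : σ.PosSemidef) :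
    (CFC.sqrt σ * CFC.sqrt ρ).trace.re ≤ fidelity ρ σ := by
  rw [fidelity_eq hσ]
  exact re_trace_le_trace_sqrt _

/-! ### Powers–Størmer and the lower fidelity bound -/

theorem norm_vec_unitary_conj {V : Mat d} (hV : V * Vᴴ = 1) (A : Mat d) :
    ‖vec (Vᴴ * A * V)‖ = ‖vec A‖ := by
  rw [← sq_eq_sq₀ (norm_nonneg _) (norm_nonneg _), norm_vec_sq, norm_vec_sq,
    ← trace_unitary_conj hV (Aᴴ * A)]
  congr 2
  simp only [Matrix.conjTranspose_mul, Matrix.conjTranspose_conjTranspose, mul_assoc]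
  rw [← mul_assoc V, hV, one_mul]

/-- The sum of the moduli of the diagonal entries is at most `√d` times the Hilbert–Schmidt
norm. -/
theorem sum_norm_diag_le (A : Mat d) : ∑ i, ‖A i i‖ ≤ √(d : ℝ) * ‖vec A‖ := by
  have h := Real.sum_mul_le_sqrt_mul_sqrt Finset.univ (fun _ : Fin d => (1 : ℝ))
    (fun i => ‖A i i‖)
  simp only [one_mul, one_pow, Finset.sum_const, Finset.card_univ, Fintype.card_fin,
    nsmul_eq_mul, mul_one] at h
  refine h.trans ?_
  gcongr
  refine Real.sqrt_le_iff.mpr ⟨norm_nonneg _, ?_⟩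
  rw [norm_vec_sq_eq_sum]
  exact Finset.sum_le_sum fun i _ => Finset.single_le_sum
    (f := fun j => ‖A i j‖ ^ 2) (fun j _ => sq_nonneg _) (Finset.mem_univ i)

/-- A Powers–Størmer inequality with the Hilbert–Schmidt norm on the right-hand side. -/
theorem norm_vec_sub_sq_le {A B : Mat d} (hA : A.PosSemidef) (hB : B.PosSemidef) :
    ‖vec (A - B)‖ ^ 2 ≤ √(d : ℝ) * ‖vec (A * A - B * B)‖ := by
  obtain ⟨V, l, hV, hV', hD⟩ :=
    exists_unitary_conj_eq_diagonal (hA.isHermitian.sub hB.isHermitian)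
  rw [← norm_vec_unitary_conj hV' (A - B), ← norm_vec_unitary_conj hV' (A * A - B * B)]
  refine le_trans ?_ (sum_norm_diag_le _)
  rw [hD, norm_vec_sq_eq_sum]
  refine Finset.sum_le_sum fun i _ => ?_
  rw [Finset.sum_eq_single i (fun j _ hj => by simp [Matrix.diagonal_apply_ne' _ hj])
    (fun h => absurd (Finset.mem_univ i) h), Matrix.diagonal_apply_eq]
  set A' := Vᴴ * A * V with hA'
  set B' := Vᴴ * B * V with hB'
  set D : Mat d := Matrix.diagonal fun i => (l i : ℂ)
  have hAB : A' - B' = D := by rw [← hD, hA', hB', mul_sub, sub_mul]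
  have hsq : Vᴴ * (A * A - B * B) * V = A' * A' - B' * B' := by
    have h (X : Mat d) : (Vᴴ * X * V) * (Vᴴ * X * V) = Vᴴ * (X * X) * V := by
      have : (Vᴴ * X * V) * (Vᴴ * X * V) = Vᴴ * X * (V * Vᴴ) * X * V := by noncomm_ring
      rw [this, hV', mul_one, mul_assoc Vᴴ X X]
    rw [h, h, mul_sub, sub_mul]
  have hDi : D i i = l i := Matrix.diagonal_apply_eq _ _
  -- Diagonal entries factor as a difference of squares although `A` and `B` need not commute, since
  -- `D = A' - B'` is diagonal.
  have hent : (Vᴴ * (A * A - B * B) * V) i i = l i * (A' i i + B' i i) := by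
    have h2 : A' i i = B' i i + l i := by
      have := congrFun (congrFun hAB i) i
      rw [Matrix.sub_apply, hDi] at this
      rw [← this]; ring
    have : A' * A' - B' * B' = D * B' + B' * D + D * D := by
      rw [← hAB]; noncomm_ring
    rw [hsq, this, Matrix.add_apply, Matrix.add_apply, Matrix.diagonal_mul, Matrix.mul_diagonal,
      Matrix.diagonal_mul_diagonal, Matrix.diagonal_apply_eq, h2]
    ring
  have ha := (hA.conjTranspose_mul_mul_same V).diag_nonneg (i := i)
  have hb := (hB.conjTranspose_mul_mul_same V).diag_nonneg (i := i)
  have hl : (l i : ℂ) = A' i i - B' i i := by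
    rw [← Matrix.sub_apply, hAB, hDi]
  have hln : ‖(l i : ℂ)‖ ≤ ‖A' i i + B' i i‖ := by
    have h1 : ‖A' i i + B' i i‖ = (A' i i).re + (B' i i).re := by
      rw [← Complex.add_re]
      exact Complex.norm_of_nonneg' (add_nonneg ha hb) |> fun h => by
        rw [← Complex.ofReal_re ‖_‖, h]
    have h2 : l i = (A' i i).re - (B' i i).re := by
      rw [← Complex.sub_re, ← hl, Complex.ofReal_re]
    have ha' := (Complex.nonneg_iff.mp ha).1
    have hb' := (Complex.nonneg_iff.mp hb).1
    rw [h1, Complex.norm_real, Real.norm_eq_abs, h2, abs_le]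
    constructor <;> linarith
  rw [hent, norm_mul, sq]
  gcongr

/-- A lower Fuchs–van de Graaf inequality in the Hilbert–Schmidt norm. -/
theorem one_sub_le_fidelity {ρ σ : Mat d} (hρ : IsDensity ρ) (hσ : IsDensity σ) :
    1 - 1 / 2 * (√(d : ℝ) * ‖vec (ρ - σ)‖) ≤ fidelity ρ σ := by
  have h := norm_vec_sub_sq_le (posSemidef_sqrt ρ) (posSemidef_sqrt σ)
  rw [sqrt_mul_sqrt hρ.1, sqrt_mul_sqrt hσ.1, norm_vec_sq, Matrix.conjTranspose_sub,
    (posSemidef_sqrt ρ).isHermitian.eq, (posSemidef_sqrt σ).isHermitian.eq, sub_mul, mul_sub,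
    mul_sub, sqrt_mul_sqrt hρ.1, sqrt_mul_sqrt hσ.1, Matrix.trace_sub, Matrix.trace_sub,
    Matrix.trace_sub, hρ.2, hσ.2, Matrix.trace_mul_comm (CFC.sqrt ρ)] at h
  simp only [Complex.sub_re, Complex.one_re] at h
  have := re_trace_sqrt_mul_sqrt_le_fidelity (ρ := ρ) hσ.1
  linarith

/-! ### The upper fidelity bound -/

/-- Each `l i` is minus the sum of the others, so `2|l i| ≤ ∑ |l j|`; multiply by `|l i|` and sum.
-/
theorem two_mul_sum_sq_le_of_sum_eq_zero {l : Fin d → ℝ} (hl : ∑ i, l i = 0) :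
    2 * ∑ i, l i ^ 2 ≤ (∑ i, |l i|) ^ 2 := by
  have key (i : Fin d) : 2 * |l i| ≤ ∑ j, |l j| := by
    have h1 := Finset.add_sum_erase Finset.univ l (Finset.mem_univ i)
    have h2 := Finset.add_sum_erase Finset.univ (fun j => |l j|) (Finset.mem_univ i)
    have h3 := Finset.abs_sum_le_sum_abs l (Finset.univ.erase i)
    have h4 : |l i| = |∑ j ∈ Finset.univ.erase i, l j| := by
      rw [← abs_neg]; congr 1; linarith
    linarith
  rw [sq, Finset.mul_sum, Finset.mul_sum]
  refine Finset.sum_le_sum fun i _ => ?_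
  have := mul_le_mul_of_nonneg_right (key i) (abs_nonneg (l i))
  rw [← sq_abs]
  linarith

/-- The classical upper Fuchs–van de Graaf inequality. -/
theorem sq_sum_abs_sub_add_le {p q : Fin d → ℝ} (hp : ∀ i, 0 ≤ p i) (hq : ∀ i, 0 ≤ q i)
    (hp1 : ∑ i, p i = 1) (hq1 : ∑ i, q i = 1) :
    (∑ i, |p i - q i|) ^ 2 + 4 * (∑ i, √(p i) * √(q i)) ^ 2 ≤ 4 := by
  -- With `B = ∑ √p √q`, Cauchy–Schwarz reads `(∑ |p - q|)² ≤ (2 - 2B)(2 + 2B)`.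
  have h := Finset.sum_mul_sq_le_sq_mul_sq Finset.univ
    (fun i => |√(p i) - √(q i)|) (fun i => √(p i) + √(q i))
  have e1 : ∑ i, |√(p i) - √(q i)| * (√(p i) + √(q i)) = ∑ i, |p i - q i| := by
    refine Finset.sum_congr rfl fun i _ => ?_
    have : p i - q i = (√(p i) - √(q i)) * (√(p i) + √(q i)) := by
      nlinarith [Real.mul_self_sqrt (hp i), Real.mul_self_sqrt (hq i)]
    rw [this, abs_mul, abs_of_nonneg (by positivity : 0 ≤ √(p i) + √(q i))]
  have e2 : ∑ i, |√(p i) - √(q i)| ^ 2 = 2 - 2 * ∑ i, √(p i) * √(q i) := by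
    have : ∀ i, |√(p i) - √(q i)| ^ 2 = p i + q i - 2 * (√(p i) * √(q i)) := fun i => by
      rw [sq_abs]; nlinarith [Real.mul_self_sqrt (hp i), Real.mul_self_sqrt (hq i)]
    simp only [this, Finset.sum_sub_distrib, Finset.sum_add_distrib, hp1, hq1, ← Finset.mul_sum]
    ring
  have e3 : ∑ i, (√(p i) + √(q i)) ^ 2 = 2 + 2 * ∑ i, √(p i) * √(q i) := by
    have : ∀ i, (√(p i) + √(q i)) ^ 2 = p i + q i + 2 * (√(p i) * √(q i)) := fun i => by
      nlinarith [Real.mul_self_sqrt (hp i), Real.mul_self_sqrt (hq i)]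
    simp only [this, Finset.sum_add_distrib, hp1, hq1, ← Finset.mul_sum]
    ring
  rw [e1, e2, e3] at h
  linarith

/-- An upper Fuchs–van de Graaf inequality in the Hilbert–Schmidt norm. -/
theorem fidelity_le_one_sub {ρ σ : Mat d} (hρ : IsDensity ρ) (hσ : IsDensity σ) :
    fidelity ρ σ ≤ 1 - 1 / 4 * ‖vec (ρ - σ)‖ ^ 2 := by
  obtain ⟨V, l, hV, hV', hD⟩ :=
    exists_unitary_conj_eq_diagonal (hρ.1.isHermitian.sub hσ.1.isHermitian)
  set p : Fin d → ℝ := fun i => ((Vᴴ * ρ * V) i i).re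
  set q : Fin d → ℝ := fun i => ((Vᴴ * σ * V) i i).re
  have hnonneg {τ : Mat d} (hτ : τ.PosSemidef) (i : Fin d) : 0 ≤ ((Vᴴ * τ * V) i i).re :=
    (Complex.nonneg_iff.mp ((hτ.conjTranspose_mul_mul_same V).diag_nonneg (i := i))).1
  have hsum {τ : Mat d} (hτ : τ.trace = 1) : ∑ i, ((Vᴴ * τ * V) i i).re = 1 := by
    rw [← Complex.re_sum]
    change (Vᴴ * τ * V).trace.re = 1
    rw [trace_unitary_conj hV', hτ, Complex.one_re]
  have hpq (i : Fin d) : p i - q i = l i := by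
    simp only [p, q]
    rw [← Complex.sub_re, ← Matrix.sub_apply, ← sub_mul, ← mul_sub, hD,
      Matrix.diagonal_apply_eq, Complex.ofReal_re]
  have hl : ∑ i, l i = 0 := by
    simp only [← hpq, Finset.sum_sub_distrib]
    exact sub_eq_zero.mpr ((hsum hρ.2).trans (hsum hσ.2).symm)
  have hnorm : ‖vec (ρ - σ)‖ ^ 2 = ∑ i, l i ^ 2 := by
    rw [← norm_vec_unitary_conj hV', hD, norm_vec_sq_eq_sum]
    refine Finset.sum_congr rfl fun i _ => ?_
    rw [Finset.sum_eq_single i (fun j _ hj => by simp [Matrix.diagonal_apply_ne' _ hj])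
      (fun h => absurd (Finset.mem_univ i) h), Matrix.diagonal_apply_eq, Complex.norm_real,
      Real.norm_eq_abs, sq_abs]
  have h1 := two_mul_sum_sq_le_of_sum_eq_zero hl
  have h2 := sq_sum_abs_sub_add_le (hnonneg hρ.1) (hnonneg hσ.1) (hsum hρ.2) (hsum hσ.2)
  have h3 := fidelity_le_sum_sqrt hρ.1 hσ.1 hV'
  have h4 : ∑ i, |p i - q i| = ∑ i, |l i| := by simp only [hpq]
  simp only [p, q] at h4
  rw [h4] at h2
  rw [hnorm]
  -- For the classical fidelity `B`, the bounds give `B² ≤ 1 - ‖ρ - σ‖²/2`, and `2B ≤ 1 + B²`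
  -- removes the square.
  nlinarith [sq_nonneg (1 - ∑ i, √((Vᴴ * ρ * V) i i).re * √((Vᴴ * σ * V) i i).re)]

/-! ### Lipschitz constants, trace preservation and circuits -/

theorem lowerLipschitz_nonneg (Φ : SuperMap d) : 0 ≤ lowerLipschitz Φ :=
  Real.iInf_nonneg fun _ => norm_nonneg _

theorem lowerLipschitz_mul_norm_le (Φ : SuperMap d) (x : EuclideanSpace ℂ (Fin d × Fin d)) :
    lowerLipschitz Φ * ‖x‖ ≤ ‖superop Φ x‖ := by
  rcases eq_or_ne x 0 with rfl | hx
  · simp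
  · have hx' : 0 < ‖x‖ := norm_pos_iff.mpr hx
    have hy : ‖((‖x‖⁻¹ : ℝ) : ℂ) • x‖ = 1 := by
      rw [norm_smul, Complex.norm_real, norm_inv, norm_norm, inv_mul_cancel₀ hx'.ne']
    have h : lowerLipschitz Φ ≤ ‖superop Φ (((‖x‖⁻¹ : ℝ) : ℂ) • x)‖ :=
      ciInf_le ⟨0, Set.forall_mem_range.mpr fun _ => norm_nonneg _⟩
        (⟨_, hy⟩ : {x : EuclideanSpace ℂ (Fin d × Fin d) // ‖x‖ = 1})
    rw [map_smul, norm_smul, Complex.norm_real, norm_inv, norm_norm] at h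
    calc lowerLipschitz Φ * ‖x‖ ≤ ‖x‖⁻¹ * ‖superop Φ x‖ * ‖x‖ := by gcongr
      _ = ‖superop Φ x‖ := by field_simp

theorem IsTracePreserving.one : IsTracePreserving (1 : SuperMap d) := fun _ => rfl

theorem IsTracePreserving.mul {Φ Ψ : SuperMap d} (hΦ : IsTracePreserving Φ)
    (hΨ : IsTracePreserving Ψ) : IsTracePreserving (Φ * Ψ) := fun X =>
  (hΦ (Ψ X)).trans (hΨ X)

theorem IsTracePreserving.list_prod {L : List (SuperMap d)}
    (hL : ∀ Φ ∈ L, IsTracePreserving Φ) : IsTracePreserving L.prod :=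
  List.prod_induction _ (fun _ _ => .mul) .one hL

theorem IsTracePreserving.symm {Φ : Mat d ≃ₗ[ℂ] Mat d}
    (hΦ : IsTracePreserving Φ.toLinearMap) : IsTracePreserving Φ.symm.toLinearMap := fun X => by
  simpa using (hΦ (Φ.symm X)).symm

theorem isTracePreserving_unitaryChannel (U : Matrix.unitaryGroup (Fin d) ℂ) :
    IsTracePreserving (unitaryChannel U) := fun X => by
  change ((U : Mat d) * X * star (U : Mat d)).trace = _
  rw [Matrix.trace_mul_comm, ← mul_assoc, Unitary.coe_star_mul_self, one_mul]

/-- A product of trace-preserving maps with a trace-annihilating factor annihilates the trace. -/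
theorem trace_list_prod_eq_zero {L : List (SuperMap d)}
    (hL : ∀ Φ ∈ L, IsTracePreserving Φ ∨ ∀ X, (Φ X).trace = 0)
    (h : ∃ Φ ∈ L, ∀ X, (Φ X).trace = 0) (X : Mat d) : (L.prod X).trace = 0 := by
  induction L with
  | nil => simp at h
  | cons Φ L ih =>
    rw [List.prod_cons, Module.End.mul_apply]
    rcases hL Φ List.mem_cons_self with hΦ | hΦ
    · obtain ⟨Ψ, hΨL, hΨ⟩ := h
      rcases List.mem_cons.mp hΨL with rfl | hΨL
      · exact hΨ _
      · rw [hΦ]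
        exact ih (fun Φ' h' => hL Φ' (List.mem_cons_of_mem _ h')) ⟨Ψ, hΨL, hΨ⟩
    · exact hΦ _

variable {n : ℕ}

theorem isTracePreserving_idealCircuit (U : Fin n → Matrix.unitaryGroup (Fin d) ℂ) :
    IsTracePreserving (idealCircuit U) :=
  .list_prod fun Φ hΦ => by
    obtain ⟨i, rfl⟩ := List.mem_ofFn.mp (List.mem_reverse.mp hΦ)
    exact isTracePreserving_unitaryChannel _

theorem posSemidef_idealOut (U : Fin n → Matrix.unitaryGroup (Fin d) ℂ) {ρ : Mat d}
    (hρ : ρ.PosSemidef) : (idealOut U ρ).PosSemidef := by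
  have : ∀ X : Mat d, X.PosSemidef → (idealCircuit U X).PosSemidef := by
    refine List.prod_induction (fun Φ : SuperMap d => ∀ X : Mat d, X.PosSemidef → (Φ X).PosSemidef)
      (fun Φ Ψ hΦ hΨ X hX => hΦ _ (hΨ X hX)) (fun X hX => hX) fun Φ hΦ X hX => ?_
    obtain ⟨i, rfl⟩ := List.mem_ofFn.mp (List.mem_reverse.mp hΦ)
    exact hX.mul_mul_conjTranspose_same (U i : Mat d)
  exact this ρ hρ

theorem isDensity_idealOut (U : Fin n → Matrix.unitaryGroup (Fin d) ℂ) {ρ : Mat d}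
    (hρ : IsDensity ρ) : IsDensity (idealOut U ρ) :=
  ⟨posSemidef_idealOut U hρ.1, (isTracePreserving_idealCircuit U ρ).trans hρ.2⟩

theorem trace_firstOrderError (U : Fin n → Matrix.unitaryGroup (Fin d) ℂ)
    {N N' : Fin n → Mat d ≃ₗ[ℂ] Mat d} (hN : ∀ i, IsTracePreserving (N i).toLinearMap)
    (hN' : ∀ i, IsTracePreserving (N' i).toLinearMap) (X : Mat d) :
    (firstOrderError U N N' X).trace = 0 := by
  have hdelta (i : Fin n) (Y : Mat d) :
      ((unitaryChannel (star (U i)) * deltaInv N N' i) Y).trace = 0 := by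
    rw [Module.End.mul_apply, isTracePreserving_unitaryChannel]
    change ((N' i).symm.toLinearMap Y - (N i).symm.toLinearMap Y).trace = 0
    rw [Matrix.trace_sub, (hN' i).symm, (hN i).symm, sub_self]
  rw [firstOrderError, LinearMap.sum_apply, Matrix.trace_sum]
  refine Finset.sum_eq_zero fun i _ => trace_list_prod_eq_zero (fun Φ hΦ => ?_)
    ⟨_, List.mem_ofFn.mpr ⟨i, rfl⟩, by simpa using hdelta i⟩ X
  obtain ⟨j, rfl⟩ := List.mem_ofFn.mp hΦ
  by_cases hj : j = i
  · exact .inr (by simpa [hj] using hdelta i)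
  · exact .inl (by simpa [hj] using (isTracePreserving_unitaryChannel _).mul (hN' j).symm)

end QEM

theorem mainTheorem3 {d n : ℕ}
    (U : Fin n → Matrix.unitaryGroup (Fin d) ℂ)
    (N N' : Fin n → QEM.Mat d ≃ₗ[ℂ] QEM.Mat d)
    (hN : ∀ i, QEM.IsChannel (N i).toLinearMap)
    (hN' : ∀ i, QEM.IsTracePreserving (N' i).toLinearMap)
    (ρ : QEM.Mat d) (hρ : QEM.IsDensity ρ)
    (hpos : (QEM.firstOrderMitigated U N N' ρ).PosSemidef) :
    ((1 / 2 : ℝ) * √(d : ℝ) * QEM.cExp U N ρ * ‖QEM.superop (QEM.firstOrderError U N N')‖ ≤ 1 →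
      (1 - (1 / 2 : ℝ) * √(d : ℝ) * QEM.cExp U N ρ *
          ‖QEM.superop (QEM.firstOrderError U N N')‖) ^ 2
        ≤ QEM.firstOrderFidelity U N N' ρ) ∧
    QEM.firstOrderFidelity U N N' ρ ≤
      1 - (1 / 4 : ℝ) * (QEM.lowerLipschitz (QEM.idealCircuit U) *
        ‖QEM.superop (QEM.firstOrderError U N N') (QEM.vec (QEM.expOut U N ρ))‖) ^ 2 := by
  have hσ := QEM.isDensity_idealOut U hρ
  have hμ : QEM.IsDensity (QEM.firstOrderMitigated U N N' ρ) := by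
    refine ⟨hpos, ?_⟩
    rw [QEM.firstOrderMitigated, Matrix.trace_add, hσ.2, QEM.isTracePreserving_idealCircuit,
      QEM.trace_firstOrderError U (fun i => (hN i).2) hN', add_zero]
  have hdiff : QEM.vec (QEM.firstOrderMitigated U N N' ρ - QEM.idealOut U ρ) =
      QEM.superop (QEM.idealCircuit U)
        (QEM.superop (QEM.firstOrderError U N N') (QEM.vec (QEM.expOut U N ρ))) := by
    rw [QEM.superop_vec, QEM.superop_vec, QEM.firstOrderMitigated, add_sub_cancel_left]
  have hlow := QEM.one_sub_le_fidelity hμ hσ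
  have hup := QEM.fidelity_le_one_sub hμ hσ
  rw [hdiff] at hlow hup
  constructor
  · intro hle
    set a := (1 / 2 : ℝ) * √(d : ℝ) * QEM.cExp U N ρ *
      ‖QEM.superop (QEM.firstOrderError U N N')‖ with ha
    have ha0 : 0 ≤ a := by
      rw [ha, QEM.cExp]; positivity
    have hbound : 1 / 2 * (√(d : ℝ) * ‖QEM.superop (QEM.idealCircuit U)
        (QEM.superop (QEM.firstOrderError U N N') (QEM.vec (QEM.expOut U N ρ)))‖) ≤ a :=
      calc _ ≤ 1 / 2 * (√(d : ℝ) * (‖QEM.superop (QEM.idealCircuit U)‖ *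
            (‖QEM.superop (QEM.firstOrderError U N N')‖ * ‖QEM.vec (QEM.expOut U N ρ)‖))) := by
            gcongr
            exact (ContinuousLinearMap.le_opNorm _ _).trans
              (by gcongr; exact ContinuousLinearMap.le_opNorm _ _)
        _ = a := by rw [ha, QEM.cExp]; ring
    -- This uses `0 ≤ a ≤ 1`; the linear bound `1 - a` is the stronger one.
    calc (1 - a) ^ 2 ≤ 1 - a := by nlinarith
      _ ≤ _ := (sub_le_sub_left hbound 1).trans hlow
  · refine hup.trans ?_
    have h := QEM.lowerLipschitz_mul_norm_le (QEM.idealCircuit U)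
      (QEM.superop (QEM.firstOrderError U N N') (QEM.vec (QEM.expOut U N ρ)))
    have h0 := QEM.lowerLipschitz_nonneg (QEM.idealCircuit U)
    gcongr
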